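/- **Proposition (worst-case disturbance).** Let $\mathcal U\subseteq\mathbb R^m$, let $\mathcal D\subseteq\mathbb R^p$ be non-empty, let $F:\mathbb R^n\times\mathcal U\times\mathcal D\to\mathbb R^n$, and fix a state-feedback controller $\mathbf u:\mathbb R^n\to\mathcal U$. Let the danger set $\mathcal X_d\subseteq\mathbb R^n$ be open and the goal set $\mathcal X_g\subseteq\mathbb R^n$ be closed. An admissible run from $x_0$ consists of a Lebesgue measurable disturbance $d(\cdot)$ with values in $\mathcal D$ and a trajectory $x(\cdot)$ with $x(0)=x_0$ that satisfies $$\dot x(t)=F\big(x(t),\mathbf u(x(t)),d(t)\big)$$ in the Carathéodory sense (that is, $s\mapsto F(x(s),\mathbf u(x(s)),d(s))$ is integrable on $[0,t]$ and $x(t)=x_0+\int_0^tF(x(s),\mathbf u(x(s)),d(s))\,ds$) up to the first time $T\in[0,\infty]$ at which $x$ reaches $\mathcal X_g$, with $T=\infty$ if it never does. Consider $$J^\star(x_0)=\sup_{d(\cdot)}\int_0^T\mathbf 1_{\mathcal X_d}(x(t))\,dt\in[0,\infty],$$ the supremum being over all admissible runs from $x_0$. A run that attains it is called worst-case. 1.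 For every $x_0\in\mathbb R^n$: no admissible run from $x_0$ enters $\mathcal X_d$ before reaching $\mathcal X_g$ (that is, $x(t)\notin\mathcal X_d$ for all $0\le t<T$) if and only if $J^\star(x_0)=0$. 2. The worst-case disturbance can be taken as a function of the state only: let $Q\subseteq\mathbb R^n$ be a countable set of initial states (for example a single initial state) such that from each $x_0\in Q$ the maximum is attained by a run with $T<\infty$. Then there is one Borel measurable map $\mathbf d^\star:\mathbb R^n\to\mathcal D$, the same for all initial states in $Q$, such that from each $x_0\in Q$ there is a worst-case run with $T<\infty$ whose disturbance is $d^\star(t)=\mathbf d^\star(x(t))$. -/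

import Mathlib

open MeasureTheory Set
open scoped ENNReal

noncomputable section

/-- The Euclidean space of dimension `n`. -/
abbrev Euc (n : ℕ) : Type := EuclideanSpace ℝ (Fin n)

/-- The times `t` with `0 ≤ t < T`, for a horizon `T` that may be infinite. -/
def timesBefore (T : ℝ≥0∞) : Set ℝ := {t | 0 ≤ t ∧ ENNReal.ofReal t < T}

/-- The real times `t` with `0 ≤ t ≤ T`, for a horizon `T` that may be infinite. -/
def timesUpTo (T : ℝ≥0∞) : Set ℝ := {t | 0 ≤ t ∧ ENNReal.ofReal t ≤ T}

/-- `IsRun F u Xg x₀ T x d`: under the state-feedback controller `u` and the Lebesgue measurable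
disturbance signal `d`, the function `x` is a Carathéodory solution, on the time interval from `0`
to `T`, of `x' = F (x, u(x), d)` with initial state `x₀`, and `T` is the first time at which `x`
is in `Xg` (`T = ∞` if that never happens). -/
structure IsRun {n m p : ℕ} {U : Set (Euc m)} {D : Set (Euc p)}
    (F : Euc n → U → D → Euc n) (u : Euc n → U) (Xg : Set (Euc n)) (x₀ : Euc n)
    (T : ℝ≥0∞) (x : ℝ → Euc n) (d : ℝ → D) : Prop where
  aemeasurable : AEMeasurable d (volume.restrict (timesBefore T))
  integrable : ∀ t ∈ timesUpTo T,
    IntervalIntegrable (fun s => F (x s) (u (x s)) (d s)) volume 0 t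
  eq_integral : ∀ t ∈ timesUpTo T,
    x t = x₀ + ∫ s in (0 : ℝ)..t, F (x s) (u (x s)) (d s)
  notMem_goal : ∀ t ∈ timesBefore T, x t ∉ Xg
  mem_goal : T ≠ ∞ → x T.toReal ∈ Xg

/-- The time that `x` spends in `Xd` before the time `T`: the integral from `0` to `T` of the
indicator function of `Xd` along `x`. -/
def dangerTime {n : ℕ} (Xd : Set (Euc n)) (T : ℝ≥0∞) (x : ℝ → Euc n) : ℝ≥0∞ :=
  ∫⁻ t in timesBefore T, Xd.indicator (fun _ => (1 : ℝ≥0∞)) (x t)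

/-- The optimal value, over all disturbances, of the time spent in `Xd` before reaching `Xg`,
from the initial state `x₀`. -/
def worstValue {n m p : ℕ} {U : Set (Euc m)} {D : Set (Euc p)}
    (F : Euc n → U → D → Euc n) (u : Euc n → U) (Xd Xg : Set (Euc n)) (x₀ : Euc n) : ℝ≥0∞ :=
  ⨆ (T : ℝ≥0∞) (x : ℝ → Euc n) (d : ℝ → D) (_ : IsRun F u Xg x₀ T x d), dangerTime Xd T x

/-- The disturbance `d`, with the trajectory `x` that it generates from `x₀` and the first
time `T` of reaching `Xg`, attains the optimal value. -/
def IsWorstCase {n m p : ℕ} {U : Set (Euc m)} {D : Set (Euc p)}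
    (F : Euc n → U → D → Euc n) (u : Euc n → U) (Xd Xg : Set (Euc n)) (x₀ : Euc n)
    (T : ℝ≥0∞) (x : ℝ → Euc n) (d : ℝ → D) : Prop :=
  IsRun F u Xg x₀ T x d ∧ dangerTime Xd T x = worstValue F u Xd Xg x₀

end

/-! Part 1 is continuity: a trajectory that meets the open set `Xd` stays there for a positive time.

For part 2, a disturbance is a function of the state once its trajectory is injective, so loops must
be erased. A maximal run of finite duration spends no time in `Xd` along a loop, since traversing
the loop twice would otherwise do better (`IsMaximalRun.timeSpent_loop`). Loops may be nested and
infinite in number, so they are erased all at once: Zorn's lemma gives a minimal closed set of times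
whose gaps have equal end states (`exists_injective_loopErasure`), and this set is traversed at unit
speed with its gaps skipped (`exists_time_change`). The result is an injective run with the same
time in `Xd`. Its track is a compact embedded arc, from which the disturbance extends to a Borel
map.

For countably many initial states, the feedback at a state is that of the least index whose track
contains it. A run that meets a track of lower index switches to it without loss, because tails of
maximal runs are optimal (`IsMaximalRun.timeSpent_tail_le`); the index only decreases, so there are
finitely many switches. -/

/-! ### Loop erasure by Zorn's lemma -/

/-- The closed subsets of `[0, T]` that arise by removing open intervals at whose ends `x` takes
the same value. -/
def loopErasures {E : Type*} (x : ℝ → E) (T : ℝ) : Set (Set ℝ) :=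
  {C | IsClosed C ∧ C ⊆ Icc 0 T ∧ 0 ∈ C ∧ T ∈ C ∧
    ∀ a ∈ C, ∀ b ∈ C, a < b → Disjoint (Ioo a b) C → x a = x b}

theorem IsClosed.exists_isGreatest_inter_Iic {C : Set ℝ} (hC : IsClosed C) {a t : ℝ}
    (ha : a ∈ C) (hat : a ≤ t) : ∃ p, a ≤ p ∧ IsGreatest (C ∩ Iic t) p := by
  obtain ⟨p, hp⟩ := (isCompact_Icc.inter_left hC : IsCompact (C ∩ Icc a t)).exists_isGreatest
    ⟨a, ha, le_rfl, hat⟩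
  refine ⟨p, hp.1.2.1, ⟨hp.1.1, hp.1.2.2⟩, fun q hq => ?_⟩
  rcases le_total a q with h | h
  · exact hp.2 ⟨hq.1, h, hq.2⟩
  · exact h.trans hp.1.2.1

theorem IsClosed.exists_isLeast_inter_Ici {C : Set ℝ} (hC : IsClosed C) {b t : ℝ}
    (hb : b ∈ C) (htb : t ≤ b) : ∃ p, p ≤ b ∧ IsLeast (C ∩ Ici t) p := by
  obtain ⟨p, hp⟩ := (isCompact_Icc.inter_left hC : IsCompact (C ∩ Icc t b)).exists_isLeast
    ⟨b, hb, htb, le_rfl⟩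
  refine ⟨p, hp.1.2.2, ⟨hp.1.1, hp.1.2.1⟩, fun q hq => ?_⟩
  rcases le_total q b with h | h
  · exact hp.2 ⟨hq.1, hq.2, h⟩
  · exact hp.1.2.2.trans h

/-- The chain condition for Zorn's lemma. By compactness, a gap of the intersection is almost a gap
of some member of the chain; the ends of that member's gap are close to `a` and `b` and have equal
states, so continuity forces `x a = x b`. -/
theorem sInter_mem_loopErasures {E : Type*} [MetricSpace E] {x : ℝ → E} {T : ℝ}
    (hx : ContinuousOn x (Icc 0 T)) {c : Set (Set ℝ)} (hc : c ⊆ loopErasures x T)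
    (hchain : IsChain (· ⊆ ·) c) (hne : c.Nonempty) : ⋂₀ c ∈ loopErasures x T := by
  obtain ⟨C₀, hC₀⟩ := hne
  refine ⟨isClosed_sInter fun C hC => (hc hC).1, (sInter_subset_of_mem hC₀).trans (hc hC₀).2.1,
    fun C hC => (hc hC).2.2.1, fun C hC => (hc hC).2.2.2.1, fun a ha b hb hab hdisj => ?_⟩
  have haI : a ∈ Icc 0 T := (hc hC₀).2.1 (ha _ hC₀)
  have hbI : b ∈ Icc 0 T := (hc hC₀).2.1 (hb _ hC₀)
  by_contra hne
  have hε : 0 < dist (x a) (x b) / 2 := half_pos (dist_pos.2 hne)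
  obtain ⟨δ₁, hδ₁, h₁⟩ := Metric.continuousOn_iff.1 hx a haI _ hε
  obtain ⟨δ₂, hδ₂, h₂⟩ := Metric.continuousOn_iff.1 hx b hbI _ hε
  obtain ⟨δ, hδ, hδ1, hδ2, hδ3⟩ : ∃ δ > 0, δ < δ₁ ∧ δ < δ₂ ∧ δ < (b - a) / 2 := by
    obtain ⟨δ, h0, h1⟩ := exists_between (lt_min (lt_min hδ₁ hδ₂) (half_pos (sub_pos.2 hab)))
    simp only [lt_min_iff] at h1
    exact ⟨δ, h0, h1.1.1, h1.1.2, h1.2⟩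
  -- Otherwise the directed compact sets `Icc (a + δ) (b - δ) ∩ C` would have a common point, which
  -- would lie in the gap `(a, b)` of the intersection.
  obtain ⟨C, hC, hCd⟩ : ∃ C ∈ c, Disjoint (Icc (a + δ) (b - δ)) C := by
    by_contra! hcon
    have : Nonempty c := ⟨⟨C₀, hC₀⟩⟩
    have := IsCompact.nonempty_iInter_of_directed_nonempty_isCompact_isClosed
      (fun C : c => Icc (a + δ) (b - δ) ∩ C) ?_ ?_ ?_ ?_
    · obtain ⟨t, ht⟩ := this
      rw [mem_iInter] at ht
      have h0 := (ht ⟨C₀, hC₀⟩).1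
      exact hdisj.le_bot ⟨⟨by linarith [h0.1], by linarith [h0.2]⟩, fun C hC => (ht ⟨C, hC⟩).2⟩
    · intro C C'
      rcases hchain.total C.2 C'.2 with h | h
      · exact ⟨C, subset_rfl, inter_subset_inter_right _ h⟩
      · exact ⟨C', inter_subset_inter_right _ h, subset_rfl⟩
    · exact fun C => not_disjoint_iff_nonempty_inter.1 (hcon C C.2)
    · exact fun C => isCompact_Icc.inter_right (hc C.2).1
    · exact fun C => isClosed_Icc.inter (hc C.2).1
  obtain ⟨hCc, hCI, -, -, hgap⟩ := hc hC
  obtain ⟨a', haa', ha'⟩ := hCc.exists_isGreatest_inter_Iic (t := a + δ) (ha C hC) (by linarith)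
  obtain ⟨b', hbb', hb'⟩ := hCc.exists_isLeast_inter_Ici (t := b - δ) (hb C hC) (by linarith)
  have ha'δ : a' ≤ a + δ := ha'.1.2
  have hb'δ : b - δ ≤ b' := hb'.1.2
  have heq : x a' = x b' := by
    refine hgap a' ha'.1.1 b' hb'.1.1 (by linarith) (disjoint_left.2 fun t ht htC => ?_)
    rcases le_total t (a + δ) with h | h
    · exact (ha'.2 ⟨htC, h⟩).not_gt ht.1
    rcases le_total t (b - δ) with h' | h'
    · exact hCd.le_bot ⟨⟨h, h'⟩, htC⟩
    · exact (hb'.2 ⟨htC, h'⟩).not_gt ht.2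
  have e1 := h₁ a' (hCI ha'.1.1) (by rw [Real.dist_eq, abs_lt]; constructor <;> linarith)
  have e2 := h₂ b' (hCI hb'.1.1) (by rw [Real.dist_eq, abs_lt]; constructor <;> linarith)
  have := dist_triangle (x a) (x a') (x b)
  rw [dist_comm (x a) (x a')] at this
  rw [← heq] at e2
  linarith

/-- Take `C` minimal. If `x a = x b`, then `C \ Ioo a b` is again a loop erasure, so minimality
leaves nothing of `C` between `a` and `b`. -/
theorem exists_injective_loopErasure {E : Type*} [MetricSpace E] {x : ℝ → E} {T : ℝ}
    (hT : 0 ≤ T) (hx : ContinuousOn x (Icc 0 T)) :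
    ∃ C ∈ loopErasures x T, ∀ a ∈ C, ∀ b ∈ C, a < b → x a = x b → Disjoint (Ioo a b) C := by
  have htop : Icc 0 T ∈ loopErasures x T := by
    refine ⟨isClosed_Icc, subset_rfl, ⟨le_rfl, hT⟩, ⟨hT, le_rfl⟩, fun a ha b hb hab hd => ?_⟩
    obtain ⟨t, ht⟩ := exists_between hab
    exact (hd.le_bot ⟨ht, ha.1.trans ht.1.le, ht.2.le.trans hb.2⟩).elim
  obtain ⟨C, hC⟩ := zorn_superset (loopErasures x T) fun c hc hchain => by
    rcases c.eq_empty_or_nonempty with rfl | hne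
    · exact ⟨_, htop, by simp⟩
    · exact ⟨_, sInter_mem_loopErasures hx hc hchain hne, fun s hs => sInter_subset_of_mem hs⟩
  refine ⟨C, hC.prop, fun a ha b hb hab hxab => ?_⟩
  obtain ⟨hcl, hI, h0, hTm, hgap⟩ := hC.prop
  have hmem : C \ Ioo a b ∈ loopErasures x T := by
    refine ⟨hcl.sdiff isOpen_Ioo, sdiff_subset.trans hI, ⟨h0, fun h => ?_⟩, ⟨hTm, fun h => ?_⟩, ?_⟩
    · exact h.1.not_ge (hI ha).1
    · exact h.2.not_ge (hI hb).2
    intro p hp q hq hpq hd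
    by_cases hpa : p < a
    · have hqa : q ≤ a := by
        by_contra! h
        exact hd.le_bot ⟨⟨hpa, h⟩, ha, fun h => lt_irrefl _ h.1⟩
      refine hgap p hp.1 q hq.1 hpq (disjoint_left.2 fun t ht htC => ?_)
      exact hd.le_bot ⟨ht, htC, fun h => (ht.2.trans_le hqa).not_gt h.1⟩
    by_cases hpb : b ≤ p
    · refine hgap p hp.1 q hq.1 hpq (disjoint_left.2 fun t ht htC => ?_)
      exact hd.le_bot ⟨ht, htC, fun h => (hpb.trans_lt ht.1).not_gt h.2⟩
    push Not at hpa hpb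
    have hpe : p = a := hpa.antisymm' (not_lt.1 fun h => hp.2 ⟨h, hpb⟩)
    subst hpe
    have hqb : b ≤ q := not_lt.1 fun h => hq.2 ⟨hpq, h⟩
    have : q = b := by
      refine hqb.antisymm' (not_lt.1 fun h => hd.le_bot ⟨⟨hpb, h⟩, hb, fun h => lt_irrefl _ h.2⟩)
    rw [this, hxab]
  have := hC.le_of_le hmem sdiff_subset
  exact disjoint_left.2 fun t ht htC => (this htC).2 ht

/-! ### Integrals over the gaps of a closed set -/

theorem exists_gap_decomposition {C : Set ℝ} (hC : IsClosed C) {t : ℝ} (h0 : 0 ∈ C) (ht : t ∈ C) :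
    ∃ (ι : Type) (_ : Countable ι) (a b : ι → ℝ),
      (∀ i, a i ∈ C ∧ b i ∈ C ∧ a i < b i ∧ 0 ≤ a i ∧ b i ≤ t ∧ Disjoint (Ioo (a i) (b i)) C) ∧
      Pairwise (Function.onFun Disjoint fun i => Ioo (a i) (b i)) ∧
      Ioc 0 t \ C = ⋃ i, Ioo (a i) (b i) := by
  let P : Set (ℝ × ℝ) := {p | p.1 ∈ C ∧ p.2 ∈ C ∧ p.1 < p.2 ∧ 0 ≤ p.1 ∧ p.2 ≤ t ∧
    Disjoint (Ioo p.1 p.2) C}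
  have hdisj : P.PairwiseDisjoint fun p => Ioo p.1 p.2 := by
    intro p hp q hq hpq
    refine disjoint_left.2 fun r hr hr' => hpq ?_
    have key : ∀ p ∈ P, ∀ q ∈ P, r ∈ Ioo p.1 p.2 → r ∈ Ioo q.1 q.2 → p.1 ≤ q.1 ∧ q.2 ≤ p.2 := by
      intro p hp q hq hr hr'
      constructor
      · exact not_lt.1 fun h => hq.2.2.2.2.2.le_bot ⟨⟨h, hr.1.trans hr'.2⟩, hp.1⟩
      · exact not_lt.1 fun h => hq.2.2.2.2.2.le_bot ⟨⟨hr'.1.trans hr.2, h⟩, hp.2.1⟩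
    have k1 := key p hp q hq hr hr'
    have k2 := key q hq p hp hr' hr
    exact Prod.ext (k1.1.antisymm k2.1) (k2.2.antisymm k1.2)
  have hcount : P.Countable := hdisj.countable_of_isOpen (fun _ _ => isOpen_Ioo)
    fun p hp => nonempty_Ioo.2 hp.2.2.1
  refine ⟨P, hcount.to_subtype, fun p => p.1.1, fun p => p.1.2, fun p => p.2, ?_, ?_⟩
  · exact fun p q hpq => hdisj p.2 q.2 (Subtype.coe_ne_coe.2 hpq)
  ext r
  simp only [mem_sdiff, mem_iUnion]
  constructor
  · rintro ⟨hr, hrC⟩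
    obtain ⟨p, hp0, hp⟩ := hC.exists_isGreatest_inter_Iic h0 hr.1.le
    obtain ⟨q, hqt, hq⟩ := hC.exists_isLeast_inter_Ici ht hr.2
    have hpr : p < r := lt_of_le_of_ne hp.1.2 fun h => hrC (h ▸ hp.1.1)
    have hrq : r < q := lt_of_le_of_ne hq.1.2 fun h => hrC (h ▸ hq.1.1)
    refine ⟨⟨(p, q), hp.1.1, hq.1.1, hpr.trans hrq, hp0, hqt, disjoint_left.2 fun z hz hzC => ?_⟩,
      hpr, hrq⟩
    rcases le_total z r with h | h
    · exact (hp.2 ⟨hzC, h⟩).not_gt hz.1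
    · exact (hq.2 ⟨hzC, h⟩).not_gt hz.2
  · rintro ⟨⟨p, hp⟩, hr⟩
    exact ⟨⟨hp.2.2.2.1.trans_lt hr.1, hr.2.le.trans hp.2.2.2.2.1⟩,
      fun h => hp.2.2.2.2.2.le_bot ⟨hr, h⟩⟩

theorem setIntegral_diff_eq_zero_of_gaps {E : Type*} [NormedAddCommGroup E] [NormedSpace ℝ E]
    {C : Set ℝ} (hC : IsClosed C) {t : ℝ} (h0 : 0 ∈ C) (ht : t ∈ C) {f : ℝ → E}
    (hf : IntegrableOn f (Ioc 0 t))
    (hgap : ∀ a ∈ C, ∀ b ∈ C, 0 ≤ a → b ≤ t → a < b → Disjoint (Ioo a b) C →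
      ∫ s in Ioc a b, f s = 0) : ∫ s in Ioc 0 t \ C, f s = 0 := by
  obtain ⟨ι, _, a, b, hab, hdisj, heq⟩ := exists_gap_decomposition hC h0 ht
  rw [heq, integral_iUnion (fun _ => measurableSet_Ioo) hdisj
    (hf.mono_set (heq ▸ sdiff_subset))]
  refine (tsum_congr fun i => ?_).trans tsum_zero
  obtain ⟨h1, h2, h3, h4, h5, h6⟩ := hab i
  rw [← integral_Ioc_eq_integral_Ioo]
  exact hgap _ h1 _ h2 h4 h5 h3 h6

theorem setLIntegral_diff_eq_zero_of_gaps
    {C : Set ℝ} (hC : IsClosed C) {t : ℝ} (h0 : 0 ∈ C) (ht : t ∈ C) {f : ℝ → ℝ≥0∞}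
    (hgap : ∀ a ∈ C, ∀ b ∈ C, 0 ≤ a → b ≤ t → a < b → Disjoint (Ioo a b) C →
      ∫⁻ s in Ioc a b, f s = 0) : ∫⁻ s in Ioc 0 t \ C, f s = 0 := by
  obtain ⟨ι, _, a, b, hab, hdisj, heq⟩ := exists_gap_decomposition hC h0 ht
  rw [heq, lintegral_iUnion (fun _ => measurableSet_Ioo) hdisj]
  refine ENNReal.tsum_eq_zero.2 fun i => ?_
  obtain ⟨h1, h2, h3, h4, h5, h6⟩ := hab i
  exact le_antisymm ((lintegral_mono_set Ioo_subset_Ioc_self).trans_eq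
    (hgap _ h1 _ h2 h4 h5 h3 h6)) zero_le

/-! ### Time change -/

/-- The set `C` can be traversed at unit speed with its gaps skipped. -/
theorem exists_time_change {C : Set ℝ} {T : ℝ} (hC : IsClosed C) (hCT : C ⊆ Icc 0 T)
    (h0 : 0 ∈ C) (hT : T ∈ C) :
    ∃ (S : ℝ) (τ : ℝ → ℝ), 0 ≤ S ∧ Measurable τ ∧ (∀ σ ∈ Icc 0 S, τ σ ∈ C) ∧ τ 0 = 0 ∧
      (∀ σ ∈ Ico 0 S, τ σ < T) ∧
      (∀ p ∈ Icc 0 S, ∀ q ∈ Icc 0 S, p < q →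
        τ p < τ q ∧ ¬ Disjoint (Ioo (τ p) (τ q)) C) ∧
      (∀ σ ∈ Icc 0 S, (volume.restrict (Ioc 0 σ)).map τ = volume.restrict (Ioc 0 (τ σ) ∩ C)) ∧
      (volume.restrict (Ioc 0 S)).map τ = volume.restrict (Ioc 0 T ∩ C) := by
  have hT0 : 0 ≤ T := (hCT hT).1
  let s : ℝ → ℝ := fun t => volume.real (Ioc 0 t ∩ C)
  have hfin : ∀ a t, volume (Ioc a t ∩ C) ≠ ∞ := fun a t =>
    ((measure_mono inter_subset_left).trans_lt measure_Ioc_lt_top).ne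
  have hsmono : Monotone s := fun a b hab =>
    measureReal_mono (inter_subset_inter_left _ (Ioc_subset_Ioc_right hab)) (hfin _ _)
  have hs0 : s 0 = 0 := by simp [s]
  have hslip : ∀ a b, a ≤ b → s b ≤ s a + volume.real (Ioc a b ∩ C) := by
    intro a b hab
    refine (measureReal_mono ?_ ?_).trans (measureReal_union_le _ _)
    · rintro r ⟨hr, hrC⟩
      rcases le_or_gt r a with h | h
      · exact Or.inl ⟨⟨hr.1, h⟩, hrC⟩
      · exact Or.inr ⟨⟨h, hr.2⟩, hrC⟩
    · exact (measure_union_lt_top (hfin _ _).lt_top (hfin _ _).lt_top).ne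
  have hscont : Continuous s := by
    refine LipschitzWith.continuous (K := 1) (LipschitzWith.of_le_add fun b a => ?_)
    rcases le_total a b with h | h
    · refine (hslip a b h).trans (add_le_add_right ?_ _)
      refine (measureReal_mono inter_subset_left measure_Ioc_lt_top.ne).trans ?_
      rw [Real.volume_real_Ioc_of_le h, Real.dist_eq]
      exact le_abs_self _
    · exact (hsmono h).trans (le_add_of_nonneg_right dist_nonneg)
  have hsT : ∀ t, s t ≤ s T := by
    intro t
    refine measureReal_mono ?_ (hfin _ _)
    exact fun r hr => ⟨⟨hr.1.1, (hCT hr.2).2⟩, hr.2⟩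
  have hS0 : 0 ≤ s T := measureReal_nonneg
  -- `τ σ` is the first time by which `C` has accumulated measure `σ`. The cap `s T` keeps `A σ`
  -- nonempty for every real `σ`, so that `τ` is monotone on the whole line.
  let A : ℝ → Set ℝ := fun σ => {t | 0 ≤ t ∧ min σ (s T) ≤ s t}
  let τ : ℝ → ℝ := fun σ => sInf (A σ)
  have hAT : ∀ σ, T ∈ A σ := fun σ => ⟨hT0, min_le_right _ _⟩
  have hAb : ∀ σ, BddBelow (A σ) := fun σ => ⟨0, fun t ht => ht.1⟩
  have hAcl : ∀ σ, IsClosed (A σ) := fun σ =>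
    isClosed_Ici.inter (isClosed_le continuous_const hscont)
  have hτA : ∀ σ, τ σ ∈ A σ := fun σ => (hAcl σ).csInf_mem ⟨T, hAT σ⟩ (hAb σ)
  have hgal : ∀ σ t, 0 ≤ t → (τ σ ≤ t ↔ min σ (s T) ≤ s t) := fun σ t ht =>
    ⟨fun h => (hτA σ).2.trans (hsmono h), fun h => csInf_le (hAb σ) ⟨ht, h⟩⟩
  have hτmono : Monotone τ := fun a b hab =>
    (hgal _ _ (hτA b).1).2 ((min_le_min_right _ hab).trans (hτA b).2)
  have hsτ : ∀ σ ∈ Icc 0 (s T), s (τ σ) = σ := by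
    intro σ hσ
    obtain ⟨t, ht, hts⟩ := intermediate_value_Icc hT0 hscont.continuousOn (hs0.symm ▸ hσ)
    refine le_antisymm ?_ ?_
    · rw [← hts]
      exact hsmono ((hgal _ _ ht.1).2 (by rw [hts]; exact min_le_left _ _))
    · exact (le_min le_rfl hσ.2).trans (hτA σ).2
  have hgap0 : ∀ a b, a ≤ b → Disjoint (Ioo a b) C → s b = s a := by
    intro a b hab hd
    refine le_antisymm ((hslip a b hab).trans ?_) (hsmono hab)
    have : volume (Ioc a b ∩ C) = 0 := by
      refine measure_mono_null (t := {b}) ?_ (by simp)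
      rintro r ⟨hr, hrC⟩
      exact hr.2.eq_or_lt.resolve_right fun h => hd.le_bot ⟨⟨hr.1, h⟩, hrC⟩
    simp [Measure.real, this]
  -- No measure of `C` accumulates after its last point `p` up to `τ σ`, so `τ σ`, being the first
  -- time, is `p`.
  have hτC : ∀ σ, τ σ ∈ C := by
    intro σ
    obtain ⟨p, hp0, hp⟩ := hC.exists_isGreatest_inter_Iic h0 (hτA σ).1
    have hpτ : p ≤ τ σ := hp.1.2
    have : s (τ σ) = s p := hgap0 p _ hpτ
      (disjoint_left.2 fun t ht htC => (hp.2 ⟨htC, ht.2.le⟩).not_gt ht.1)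
    have h2 : τ σ ≤ p := (hgal _ _ hp0).2 (this ▸ (hτA σ).2)
    exact hpτ.antisymm h2 ▸ hp.1.1
  -- Any `t` with `s t = σ` is allowed, because both `τ (s T)` and `T` are needed; they differ if
  -- `C` ends in a null part.
  have hmap : ∀ σ ∈ Icc 0 (s T), ∀ t, s t = σ → (volume.restrict (Ioc 0 σ)).map τ =
      volume.restrict (Ioc 0 t ∩ C) := by
    intro σ hσ t hst
    have : IsFiniteMeasure (volume.restrict (Ioc 0 t ∩ C)) := ⟨by simpa using (hfin 0 t).lt_top⟩
    refine Measure.ext_of_Iic _ _ fun r => ?_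
    rw [Measure.map_apply hτmono.measurable measurableSet_Iic,
      Measure.restrict_apply (hτmono.measurable measurableSet_Iic),
      Measure.restrict_apply measurableSet_Iic]
    rcases lt_or_ge r 0 with hr | hr
    · rw [(_ : τ ⁻¹' Iic r ∩ Ioc 0 σ = ∅), (_ : Iic r ∩ (Ioc 0 t ∩ C) = ∅)]
      · exact eq_empty_of_forall_notMem fun z hz => (hz.2.1.1.trans_le hz.1).not_gt hr
      · exact eq_empty_of_forall_notMem fun z hz => ((hτA z).1.trans hz.1).not_gt hr
    · have e1 : τ ⁻¹' Iic r ∩ Ioc 0 σ = Ioc 0 (min σ (s r)) := by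
        ext z
        simp only [mem_inter_iff, mem_preimage, mem_Iic, mem_Ioc, le_min_iff]
        constructor
        · rintro ⟨h1, h2, h3⟩
          refine ⟨h2, h3, ?_⟩
          simpa [min_eq_left (h3.trans hσ.2)] using (hgal _ _ hr).1 h1
        · rintro ⟨h1, h2, h3⟩
          exact ⟨(hgal _ _ hr).2 ((min_le_left _ _).trans h3), h1, h2⟩
      have e2 : Iic r ∩ (Ioc 0 t ∩ C) = Ioc 0 (min t r) ∩ C := by
        ext z
        simp only [mem_inter_iff, mem_Iic, mem_Ioc, le_min_iff]
        tauto
      rw [e1, e2, Real.volume_Ioc, sub_zero, ← hst, ← hsmono.map_min]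
      exact ENNReal.ofReal_toReal (hfin _ _)
  refine ⟨s T, τ, hS0, hτmono.measurable, fun σ _ => hτC σ, ?_, ?_, ?_, ?_, ?_⟩
  · exact ((hgal 0 0 le_rfl).2 (by rw [hs0]; exact min_le_left _ _)).antisymm (hτA 0).1
  · intro σ hσ
    by_contra! h
    have := hsmono h
    rw [hsτ σ ⟨hσ.1, hσ.2.le⟩] at this
    exact this.not_gt hσ.2
  · intro p hp q hq hpq
    refine ⟨?_, fun hd => ?_⟩
    · by_contra! h
      have := hsmono h
      rw [hsτ p hp, hsτ q hq] at this
      exact this.not_gt hpq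
    · have := hgap0 _ _ (hτmono hpq.le) hd
      rw [hsτ p hp, hsτ q hq] at this
      exact hpq.ne' this
  · exact fun σ hσ => hmap σ hσ _ (hsτ σ hσ)
  · exact hmap _ ⟨hS0, le_rfl⟩ T rfl

/-! ### Time spent in a set -/

section TimeSpent

variable {E : Type*}

/-- The time that `x` spends in `Xd` between the times `a` and `b`. -/
noncomputable def timeSpent (Xd : Set E) (a b : ℝ) (x : ℝ → E) : ℝ≥0∞ :=
  ∫⁻ t in Ioc a b, Xd.indicator (fun _ => (1 : ℝ≥0∞)) (x t)

variable {Xd : Set E} {a b c : ℝ} {x x' x₁ x₂ : ℝ → E}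

theorem timeSpent_add (hab : a ≤ b) (hbc : b ≤ c) :
    timeSpent Xd a b x + timeSpent Xd b c x = timeSpent Xd a c x := by
  rw [timeSpent, timeSpent, timeSpent, ← Ioc_union_Ioc_eq_Ioc hab hbc,
    lintegral_union measurableSet_Ioc]
  exact Ioc_disjoint_Ioc_of_le le_rfl

theorem timeSpent_ne_top : timeSpent Xd a b x ≠ ∞ := by
  refine ne_top_of_le_ne_top (measure_Ioc_lt_top (a := a) (b := b) (μ := volume)).ne ?_
  refine (lintegral_mono fun t => indicator_le_self' (fun _ _ => zero_le) _).trans_eq ?_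
  simp

theorem timeSpent_congr_ae (h : ∀ᵐ t ∂volume.restrict (Ioc a b), x t = x' t) :
    timeSpent Xd a b x = timeSpent Xd a b x' :=
  lintegral_congr_ae (h.mono fun t ht => by simp only [ht])

theorem timeSpent_shift (c : ℝ) :
    timeSpent Xd (a + c) (b + c) (fun t => x (t - c)) = timeSpent Xd a b x := by
  have := (measurePreserving_sub_right (volume : Measure ℝ) c).setLIntegral_comp_preimage_emb
    (measurableEmbedding_subRight c) (fun t => Xd.indicator (fun _ => (1 : ℝ≥0∞)) (x t)) (Ioc a b)
  rwa [preimage_sub_const_Ioc] at this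

theorem timeSpent_concat (hab : a ≤ b) (hbc : b ≤ c) :
    timeSpent Xd a c (fun t => if t < b then x₁ t else x₂ t) =
      timeSpent Xd a b x₁ + timeSpent Xd b c x₂ := by
  rw [← timeSpent_add hab hbc]
  congr 1
  · refine timeSpent_congr_ae ?_
    rw [← restrict_Ioo_eq_restrict_Ioc]
    exact (ae_restrict_mem measurableSet_Ioo).mono fun t ht => by simp [ht.2]
  · refine timeSpent_congr_ae ?_
    exact (ae_restrict_mem measurableSet_Ioc).mono fun t ht => by simp [not_lt.2 ht.1.le]

end TimeSpent

/-! ### Restricting, shifting and joining trajectories -/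

section Segments

variable {E D : Type*} [NormedAddCommGroup E] [NormedSpace ℝ E] [MeasurableSpace D]

/-- The function `x` is a Carathéodory solution of `x' = v (x, d)` on `[a, b]` that avoids `Xg`
on `[a, b)`. -/
structure IsSegment (v : E → D → E) (Xg : Set E) (a b : ℝ) (x : ℝ → E) (d : ℝ → D) : Prop where
  le : a ≤ b
  aemeasurable : AEMeasurable d (volume.restrict (Ioc a b))
  integrableOn : IntegrableOn (fun s => v (x s) (d s)) (Ioc a b)
  eq_integral : ∀ t ∈ Icc a b, x t = x a + ∫ s in Ioc a t, v (x s) (d s)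
  notMem : ∀ t ∈ Ico a b, x t ∉ Xg

variable {v : E → D → E} {Xg Xd : Set E} {a b c : ℝ} {x x' x₁ x₂ : ℝ → E} {d d' d₁ d₂ : ℝ → D}

namespace IsSegment

theorem mono (h : IsSegment v Xg a b x d) {a' b' : ℝ} (ha : a ≤ a') (hab : a' ≤ b')
    (hb : b' ≤ b) : IsSegment v Xg a' b' x d where
  le := hab
  aemeasurable := h.aemeasurable.mono_set (Ioc_subset_Ioc ha hb)
  integrableOn := h.integrableOn.mono_set (Ioc_subset_Ioc ha hb)
  eq_integral t ht := by
    rw [h.eq_integral t ⟨ha.trans ht.1, ht.2.trans hb⟩, h.eq_integral a' ⟨ha, hab.trans hb⟩,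
      ← Ioc_union_Ioc_eq_Ioc ha ht.1, setIntegral_union (Ioc_disjoint_Ioc_of_le le_rfl)
        measurableSet_Ioc, add_assoc]
    · exact h.integrableOn.mono_set (Ioc_subset_Ioc le_rfl (hab.trans hb))
    · exact h.integrableOn.mono_set (Ioc_subset_Ioc ha (ht.2.trans hb))
  notMem t ht := h.notMem t ⟨ha.trans ht.1, ht.2.trans_le hb⟩

theorem congr (h : IsSegment v Xg a b x d) (hx : EqOn x x' (Icc a b))
    (hd : ∀ᵐ t ∂volume.restrict (Ioc a b), d t = d' t) : IsSegment v Xg a b x' d' := by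
  have hae : ∀ᵐ t ∂volume.restrict (Ioc a b), v (x t) (d t) = v (x' t) (d' t) := by
    filter_upwards [hd, ae_restrict_mem measurableSet_Ioc] with t ht ht'
    rw [ht, hx ⟨ht'.1.le, ht'.2⟩]
  refine ⟨h.le, h.aemeasurable.congr hd, h.integrableOn.congr hae, fun t ht => ?_, fun t ht => ?_⟩
  · rw [← hx ht, ← hx ⟨le_rfl, h.le⟩, h.eq_integral t ht]
    congr 1
    exact integral_congr_ae (ae_restrict_of_ae_restrict_of_subset
      (Ioc_subset_Ioc le_rfl ht.2) hae)
  · rw [← hx ⟨ht.1, ht.2.le⟩]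
    exact h.notMem t ht

theorem shift (h : IsSegment v Xg a b x d) (c : ℝ) :
    IsSegment v Xg (a + c) (b + c) (fun t => x (t - c)) (fun t => d (t - c)) := by
  have hmp := measurePreserving_sub_right (volume : Measure ℝ) c
  have hemb := measurableEmbedding_subRight (G := ℝ) c
  refine ⟨by linarith [h.le], ?_, ?_, fun t ht => ?_, fun t ht => ?_⟩
  · have := hmp.restrict_preimage (measurableSet_Ioc (a := a) (b := b))
    rw [preimage_sub_const_Ioc] at this
    exact h.aemeasurable.comp_quasiMeasurePreserving this.quasiMeasurePreserving
  · have := (hmp.integrableOn_comp_preimage hemb).2 h.integrableOn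
    rwa [preimage_sub_const_Ioc] at this
  · have := hmp.setIntegral_preimage_emb hemb (fun s => v (x s) (d s)) (Ioc a (t - c))
    rw [preimage_sub_const_Ioc, sub_add_cancel] at this
    rw [this, add_sub_cancel_right]
    exact h.eq_integral _ ⟨by linarith [ht.1], by linarith [ht.2]⟩
  · exact h.notMem _ ⟨by linarith [ht.1], by linarith [ht.2]⟩

theorem join (h₁ : IsSegment v Xg a b x d) (h₂ : IsSegment v Xg b c x d) :
    IsSegment v Xg a c x d := by
  have hu := Ioc_union_Ioc_eq_Ioc h₁.le h₂.le
  refine ⟨h₁.le.trans h₂.le, ?_, ?_, fun t ht => ?_, fun t ht => ?_⟩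
  · rw [← hu]
    exact aemeasurable_union_iff.2 ⟨h₁.aemeasurable, h₂.aemeasurable⟩
  · rw [← hu]
    exact h₁.integrableOn.union h₂.integrableOn
  · rcases le_total t b with h | h
    · exact h₁.eq_integral t ⟨ht.1, h⟩
    · rw [h₂.eq_integral t ⟨h, ht.2⟩, h₁.eq_integral b ⟨h₁.le, le_rfl⟩,
        ← Ioc_union_Ioc_eq_Ioc h₁.le h, setIntegral_union (Ioc_disjoint_Ioc_of_le le_rfl)
        measurableSet_Ioc h₁.integrableOn, add_assoc]
      exact h₂.integrableOn.mono_set (Ioc_subset_Ioc le_rfl ht.2)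
  · rcases lt_or_ge t b with h | h
    · exact h₁.notMem t ⟨ht.1, h⟩
    · exact h₂.notMem t ⟨h, ht.2⟩

theorem concat (h₁ : IsSegment v Xg a b x₁ d₁) (h₂ : IsSegment v Xg b c x₂ d₂)
    (h : x₁ b = x₂ b) :
    IsSegment v Xg a c (fun t => if t < b then x₁ t else x₂ t)
      (fun t => if t < b then d₁ t else d₂ t) := by
  refine join (h₁.congr (fun t ht => ?_) ?_) (h₂.congr (fun t ht => ?_) ?_)
  · rcases ht.2.lt_or_eq with h' | rfl
    · simp [h']
    · simp [h]
  · rw [← restrict_Ioo_eq_restrict_Ioc]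
    exact (ae_restrict_mem measurableSet_Ioo).mono fun t ht => by simp [ht.2]
  · simp [not_lt.2 ht.1]
  · exact (ae_restrict_mem measurableSet_Ioc).mono fun t ht => by simp [not_lt.2 ht.1.le]

theorem continuousOn (h : IsSegment v Xg a b x d) : ContinuousOn x (Icc a b) := by
  have hI : IntegrableOn (fun s => v (x s) (d s)) (Icc a b) :=
    (integrableOn_Icc_iff_integrableOn_Ioc (by finiteness)).2 h.integrableOn
  exact (continuousOn_const.add
    (intervalIntegral.continuousOn_primitive hI)).congr h.eq_integral

end IsSegment

/-- Following one segment up to the time `b` and then another one from the time `c`, at which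
it is at the same place. -/
theorem IsSegment.splice {T : ℝ} (h₁ : IsSegment v Xg a b x₁ d₁) (h₂ : IsSegment v Xg c T x₂ d₂)
    (h : x₁ b = x₂ c) :
    IsSegment v Xg a (b + (T - c)) (fun t => if t < b then x₁ t else x₂ (t - (b - c)))
      (fun t => if t < b then d₁ t else d₂ (t - (b - c))) ∧
    timeSpent Xd a (b + (T - c)) (fun t => if t < b then x₁ t else x₂ (t - (b - c))) =
      timeSpent Xd a b x₁ + timeSpent Xd c T x₂ := by
  have hs := h₂.shift (b - c)
  have ht := timeSpent_shift (Xd := Xd) (x := x₂) (a := c) (b := T) (b - c)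
  rw [add_sub_cancel, (by ring : T + (b - c) = b + (T - c))] at hs ht
  refine ⟨h₁.concat hs (by simpa using h), ?_⟩
  rw [timeSpent_concat h₁.le hs.le, ht]

end Segments

/-! ### Maximal runs and feedback -/

section FiniteRuns

variable {E D : Type*} [NormedAddCommGroup E] [NormedSpace ℝ E] [MeasurableSpace D]

/-- A segment from `z` that ends in `Xg`. -/
structure IsFiniteRun (v : E → D → E) (Xg : Set E) (z : E) (T : ℝ) (x : ℝ → E) (d : ℝ → D) :
    Prop extends IsSegment v Xg 0 T x d where
  init : x 0 = z
  mem : x T ∈ Xg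

variable {v : E → D → E} {Xg Xd : Set E} {a b T T₁ T₂ : ℝ} {x x₁ x₂ : ℝ → E} {d d₁ d₂ : ℝ → D}
  {z z₁ z₂ : E}

/-- A run that spends at least as much time in `Xd` as any other run of finite duration. -/
structure IsMaximalRun (v : E → D → E) (Xd Xg : Set E) (z : E) (T : ℝ) (x : ℝ → E)
    (d : ℝ → D) : Prop extends IsFiniteRun v Xg z T x d where
  max : ∀ T' x' d', IsFiniteRun v Xg z T' x' d' → timeSpent Xd 0 T' x' ≤ timeSpent Xd 0 T x

theorem IsFiniteRun.splice (h₁ : IsSegment v Xg 0 b x₁ d₁) (h₂ : IsSegment v Xg a T x₂ d₂)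
    (h : x₁ b = x₂ a) (hT : x₂ T ∈ Xg) :
    IsFiniteRun v Xg (x₁ 0) (b + (T - a)) (fun t => if t < b then x₁ t else x₂ (t - (b - a)))
      (fun t => if t < b then d₁ t else d₂ (t - (b - a))) := by
  refine ⟨(IsSegment.splice (Xd := ∅) h₁ h₂ h).1, ?_, ?_⟩
  · rcases h₁.le.lt_or_eq with h' | rfl
    · simp [h']
    · simp [h]
  · have := h₂.le
    rw [if_neg (by linarith), (by ring : b + (T - a) - (b - a) = T)]
    exact hT

/-- The head of the first run followed by the tail of the second is a competitor; the time spent on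
the common head is finite and cancels. -/
theorem IsMaximalRun.timeSpent_tail_le (h₁ : IsMaximalRun v Xd Xg z₁ T₁ x₁ d₁)
    (h₂ : IsFiniteRun v Xg z₂ T₂ x₂ d₂) (hb : b ∈ Icc 0 T₁) (ha : a ∈ Icc 0 T₂)
    (h : x₁ b = x₂ a) : timeSpent Xd a T₂ x₂ ≤ timeSpent Xd b T₁ x₁ := by
  have s₁ := h₁.toIsSegment.mono le_rfl hb.1 hb.2
  have s₂ := h₂.toIsSegment.mono ha.1 ha.2 le_rfl
  have := h₁.max _ _ _ (h₁.init ▸ IsFiniteRun.splice s₁ s₂ h h₂.mem)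
  rw [(s₁.splice s₂ h).2, ← timeSpent_add hb.1 hb.2] at this
  exact (ENNReal.add_le_add_iff_left timeSpent_ne_top).1 this

/-- Going back from time `b` to the tail from `a` repeats the loop, which must not gain anything. -/
theorem IsMaximalRun.timeSpent_loop (h : IsMaximalRun v Xd Xg z T x d) (ha : 0 ≤ a) (hab : a ≤ b)
    (hb : b ≤ T) (hx : x a = x b) : timeSpent Xd a b x = 0 := by
  have := h.timeSpent_tail_le h.toIsFiniteRun ⟨ha.trans hab, hb⟩ ⟨ha, hab.trans hb⟩ hx.symm
  rw [← timeSpent_add hab hb] at this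
  by_contra hne
  exact this.not_gt (by
    rw [add_comm]; exact ENNReal.lt_add_right timeSpent_ne_top hne)

/-- A maximal run without loops. -/
theorem IsMaximalRun.exists_injOn [MeasurableSpace E] [BorelSpace E] (hXd : IsOpen Xd)
    (h : IsMaximalRun v Xd Xg z T x d) :
    ∃ T' x' d', IsMaximalRun v Xd Xg z T' x' d' ∧ InjOn x' (Icc 0 T') := by
  have hcont := h.continuousOn
  obtain ⟨C, ⟨hC, hCT, h0, hT, hgap⟩, hinj⟩ := exists_injective_loopErasure h.le hcont
  obtain ⟨S, τ, hS, hτ, hτC, hτ0, hτT, hτlt, hτmap, hτmapS⟩ := exists_time_change hC hCT h0 hT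
  -- Each gap has equal end states, so the integral of the velocity over it vanishes.
  have hCint : ∀ t ∈ C, x t = x 0 + ∫ s in Ioc 0 t ∩ C, v (x s) (d s) := by
    intro t ht
    have hint := h.integrableOn.mono_set (Ioc_subset_Ioc le_rfl (hCT ht).2)
    rw [h.eq_integral t (hCT ht), ← integral_inter_add_sdiff hC.measurableSet hint,
      setIntegral_diff_eq_zero_of_gaps hC h0 ht hint, add_zero]
    intro a ha b hb h0a hbt hab hd
    have h1 := (h.toIsSegment.mono h0a hab.le (hCT hb).2).eq_integral b ⟨hab.le, le_rfl⟩
    rw [hgap a ha b hb hab hd] at h1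
    exact left_eq_add.1 h1
  have hCtime : timeSpent Xd 0 T x =
      ∫⁻ t in Ioc 0 T ∩ C, Xd.indicator (fun _ => (1 : ℝ≥0∞)) (x t) := by
    rw [timeSpent, ← lintegral_inter_add_sdiff _ _ hC.measurableSet,
      setLIntegral_diff_eq_zero_of_gaps hC h0 hT, add_zero]
    intro a ha b hb h0a hbt hab hd
    exact h.timeSpent_loop h0a hab.le hbt (hgap a ha b hb hab hd)
  have hτint : ∀ σ ∈ Icc 0 S,
      IntegrableOn (fun s => v (x (τ s)) (d (τ s))) (Ioc 0 σ) ∧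
      ∫ s in Ioc 0 σ, v (x (τ s)) (d (τ s)) = ∫ s in Ioc 0 (τ σ) ∩ C, v (x s) (d s) := by
    intro σ hσ
    have hint : Integrable (fun s => v (x s) (d s)) ((volume.restrict (Ioc 0 σ)).map τ) := by
      rw [hτmap σ hσ]
      exact h.integrableOn.mono_set
        (inter_subset_left.trans (Ioc_subset_Ioc le_rfl (hCT (hτC σ hσ)).2))
    refine ⟨hint.comp_measurable hτ, ?_⟩
    rw [← hτmap σ hσ, integral_map hτ.aemeasurable hint.1]
  have hSS : S ∈ Icc 0 S := ⟨hS, le_rfl⟩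
  have hrun : IsFiniteRun v Xg z S (x ∘ τ) (d ∘ τ) := by
    refine ⟨⟨hS, ?_, (hτint S hSS).1, fun σ hσ => ?_, fun σ hσ => ?_⟩, ?_, ?_⟩
    · refine AEMeasurable.comp_measurable ?_ hτ
      rw [hτmapS]
      exact h.aemeasurable.mono_set inter_subset_left
    · simp only [Function.comp_apply]
      rw [(hτint σ hσ).2, hτ0]
      exact hCint _ (hτC σ hσ)
    · exact h.notMem _ ⟨(hCT (hτC σ ⟨hσ.1, hσ.2.le⟩)).1, hτT σ hσ⟩
    · simp [hτ0, h.init]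
    · have e1 := hCint T hT
      rw [← hτmapS, hτmap S hSS, ← hCint _ (hτC S hSS)] at e1
      exact (e1 ▸ h.mem : x (τ S) ∈ Xg)
  have htime : timeSpent Xd 0 S (x ∘ τ) = timeSpent Xd 0 T x := by
    rw [hCtime, ← hτmapS, lintegral_map' _ hτ.aemeasurable]
    · rfl
    rw [hτmapS]
    have hxm : AEMeasurable x (volume.restrict (Ioc 0 T ∩ C)) :=
      (hcont.aemeasurable measurableSet_Icc).mono_set (inter_subset_left.trans Ioc_subset_Icc_self)
    exact (measurable_const.indicator hXd.measurableSet).comp_aemeasurable hxm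
  refine ⟨S, x ∘ τ, d ∘ τ, ⟨hrun, fun T' x' d' h' => htime ▸ h.max T' x' d' h'⟩, ?_⟩
  intro p hp q hq hpq
  by_contra hne
  wlog hlt : p < q generalizing p q
  · exact this hq hp hpq.symm (Ne.symm hne) ((not_lt.1 hlt).lt_of_ne (Ne.symm hne))
  -- Times of `C` with equal states bound a gap, whereas `τ` at distinct times has points of `C`
  -- strictly in between.
  obtain ⟨h1, h2⟩ := hτlt p hp q hq hlt
  exact h2 (hinj _ (hτC p hp) _ (hτC q hq) h1 hpq)

/-- A maximal run can be driven by a feedback law. -/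
theorem IsMaximalRun.exists_feedback [MeasurableSpace E] [BorelSpace E] [Nonempty D]
    (hXd : IsOpen Xd) (h : IsMaximalRun v Xd Xg z T x d) :
    ∃ T' x', ∃ e : E → D, Measurable e ∧ IsMaximalRun v Xd Xg z T' x' (fun t => e (x' t)) := by
  obtain ⟨T', x', d', h', hinj⟩ := h.exists_injOn hXd
  let f : Icc 0 T' → E := (Icc 0 T').domRestrict x'
  -- A continuous injection of a compact interval is a closed embedding.
  have hf : MeasurableEmbedding f :=
    (((continuousOn_iff_continuous_domRestrict.1 h'.continuousOn).isClosedEmbedding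
      (injOn_iff_injective.1 hinj))).measurableEmbedding
  obtain ⟨e, he, hef⟩ := hf.exists_measurable_extend
    (h'.aemeasurable.measurable_mk.comp measurable_subtype_coe) fun _ => inferInstance
  refine ⟨T', x', e, he, ⟨⟨h'.toIsSegment.congr (fun _ _ => rfl) ?_, h'.init, h'.mem⟩, h'.max⟩⟩
  filter_upwards [h'.aemeasurable.ae_eq_mk, ae_restrict_mem measurableSet_Ioc] with t ht ht'
  rw [ht]
  exact (congrFun hef ⟨t, ht'.1.le, ht'.2⟩).symm

/-- One feedback law drives maximal runs from countably many initial states. -/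
theorem exists_common_feedback [MeasurableSpace E] [BorelSpace E]
    (z : ℕ → E) (T : ℕ → ℝ) (x : ℕ → ℝ → E) (e : ℕ → E → D) (he : ∀ k, Measurable (e k))
    (hrun : ∀ k, IsMaximalRun v Xd Xg (z k) (T k) (x k) (fun t => e k (x k t))) :
    ∃ f : E → D, Measurable f ∧ ∀ k, ∃ T' x', IsFiniteRun v Xg (z k) T' x' (fun t => f (x' t)) ∧
      timeSpent Xd 0 (T k) (x k) ≤ timeSpent Xd 0 T' x' := by
  classical
  let K : ℕ → Set E := fun k => x k '' Icc 0 (T k)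
  have hK : ∀ k, IsClosed (K k) := fun k =>
    (isCompact_Icc.image_of_continuousOn (hrun k).continuousOn).isClosed
  -- The second alternative only makes the search total: off all tracks the index is `0`.
  let P : ℕ → E → Prop := fun k y => y ∈ K k ∨ ∀ j, y ∉ K j
  have hP : ∀ y, ∃ k, P k y := fun y => by
    by_cases hy : ∃ k, y ∈ K k
    · exact hy.imp fun k hk => Or.inl hk
    · exact ⟨0, Or.inr (not_exists.1 hy)⟩
  let f : E → D := fun y => e (Nat.find (hP y)) y
  have hf : Measurable f := by
    refine Measurable.find he (fun k => ?_) hP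
    refine (hK k).measurableSet.union ?_
    have hcompl : {y | ∀ j, y ∉ K j} = ⋂ j, (K j)ᶜ := by ext; simp
    change MeasurableSet {y | ∀ j, y ∉ K j}
    rw [hcompl]
    exact MeasurableSet.iInter fun j => (hK j).measurableSet.compl
  have hfe : ∀ k, ∀ y ∈ K k, (∀ j < k, y ∉ K j) → f y = e k y := by
    intro k y hy hlt
    have : Nat.find (hP y) = k := (Nat.find_eq_iff _).2
      ⟨Or.inl hy, fun j hj => not_or.2 ⟨hlt j hj, fun h => h k hy⟩⟩
    simp only [f, this]
  refine ⟨f, hf, ?_⟩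
  -- The induction needs every starting point on the track, since a switch may happen anywhere along
  -- it.
  suffices H : ∀ k, ∀ s ∈ Icc 0 (T k), ∃ T' x', IsFiniteRun v Xg (x k s) T' x' (fun t => f (x' t)) ∧
      timeSpent Xd s (T k) (x k) ≤ timeSpent Xd 0 T' x' by
    intro k
    have := H k 0 ⟨le_rfl, (hrun k).le⟩
    rwa [(hrun k).init] at this
  intro k
  induction k using Nat.strong_induction_on with
  | _ k ih =>
  intro s hs
  have hseg : ∀ r, s ≤ r → r ≤ T k → (∀ t ∈ Ico s r, ∀ j < k, x k t ∉ K j) →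
      IsSegment v Xg 0 (r - s) (fun t => x k (t + s)) (fun t => f (x k (t + s))) ∧
      timeSpent Xd 0 (r - s) (fun t => x k (t + s)) = timeSpent Xd s r (x k) := by
    intro r hsr hr hlt
    have h1 := (hrun k).toIsSegment.mono hs.1 hsr hr
    have h2 : IsSegment v Xg s r (x k) (fun t => f (x k t)) := by
      refine h1.congr (fun _ _ => rfl) ?_
      rw [← restrict_Ioo_eq_restrict_Ioc]
      refine (ae_restrict_mem measurableSet_Ioo).mono fun t ht => ?_
      exact (hfe k _ ⟨t, ⟨hs.1.trans ht.1.le, ht.2.le.trans hr⟩, rfl⟩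
        (hlt t ⟨ht.1.le, ht.2⟩)).symm
    have h3 := h2.shift (-s)
    have h4 := timeSpent_shift (Xd := Xd) (x := x k) (a := s) (b := r) (-s)
    simp only [sub_neg_eq_add, add_neg_cancel, ← sub_eq_add_neg] at h3 h4
    exact ⟨h3, h4⟩
  -- Only finitely many tracks have index below `k`, so their union is closed and there is a first
  -- time of meeting it.
  let B : Set ℝ := {t | t ∈ Icc s (T k) ∧ x k t ∈ ⋃ j ∈ Iio k, K j}
  have hB : IsCompact B := by
    have hc : ContinuousOn (x k) (Icc s (T k)) :=
      (hrun k).continuousOn.mono (Icc_subset_Icc hs.1 le_rfl)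
    refine isCompact_Icc.of_isClosed_subset ?_ (fun t ht => ht.1)
    exact hc.preimage_isClosed_of_isClosed isClosed_Icc
      ((finite_Iio k).isClosed_biUnion fun j _ => hK j)
  rcases B.eq_empty_or_nonempty with hBe | hBn
  · obtain ⟨h1, h2⟩ := hseg (T k) hs.2 le_rfl fun t ht j hj hxt =>
      (hBe ▸ (⟨⟨ht.1, ht.2.le⟩, mem_biUnion (mem_Iio.2 hj) hxt⟩ : t ∈ B) : t ∈ (∅ : Set ℝ))
    refine ⟨T k - s, fun t => x k (t + s), ⟨h1, by simp, ?_⟩, h2.ge⟩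
    simpa using (hrun k).mem
  · obtain ⟨r, ⟨hr, hrK⟩, hrmin⟩ := hB.exists_isLeast hBn
    obtain ⟨h1, h2⟩ := hseg r hr.1 hr.2 fun t ht j hj hxt =>
      (hrmin ⟨⟨ht.1, ht.2.le.trans hr.2⟩, mem_biUnion (mem_Iio.2 hj) hxt⟩).not_gt ht.2
    obtain ⟨j, hj, q, hq, hqr⟩ := mem_iUnion₂.1 hrK
    obtain ⟨T', x', hx', hle⟩ := ih j hj q hq
    have htail := (hrun j).timeSpent_tail_le (hrun k).toIsFiniteRun hq ⟨hs.1.trans hr.1, hr.2⟩ hqr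
    have hmeet : (fun t => x k (t + s)) (r - s) = x' 0 := by simp [hx'.init, hqr]
    have hfin := IsFiniteRun.splice h1 hx'.toIsSegment hmeet hx'.mem
    have htime := (h1.splice (Xd := Xd) hx'.toIsSegment hmeet).2
    simp only [zero_add, ← apply_ite f] at hfin
    refine ⟨_, _, hfin, ?_⟩
    rw [htime, h2, ← timeSpent_add hr.1 hr.2]
    exact add_le_add_right (htail.trans hle) _

end FiniteRuns

/-! ### From runs of the control system to segments -/

section ClosedLoop

variable {n m p : ℕ} {U : Set (Euc m)} {D : Set (Euc p)} {F : Euc n → U → D → Euc n}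
  {u : Euc n → U} {Xd Xg : Set (Euc n)} {x₀ : Euc n} {x : ℝ → Euc n} {d : ℝ → D}

theorem timesBefore_ofReal (t : ℝ) : timesBefore (ENNReal.ofReal t) = Ico 0 t := by
  ext s
  simp only [timesBefore, mem_ofPred_eq, mem_Ico]
  exact and_congr_right fun hs => ENNReal.ofReal_lt_ofReal_iff_of_nonneg hs

theorem timesBefore_mono {S T : ℝ≥0∞} (h : S ≤ T) : timesBefore S ⊆ timesBefore T :=
  fun _ ht => ⟨ht.1, ht.2.trans_le h⟩

theorem timesUpTo_ofReal {t : ℝ} (ht : 0 ≤ t) : timesUpTo (ENNReal.ofReal t) = Icc 0 t := by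
  ext s
  simp only [timesUpTo, mem_ofPred_eq, mem_Icc]
  exact and_congr_right fun _ => ENNReal.ofReal_le_ofReal_iff ht

theorem timesUpTo_mono {S T : ℝ≥0∞} (h : S ≤ T) : timesUpTo S ⊆ timesUpTo T :=
  fun _ ht => ⟨ht.1, ht.2.trans h⟩

theorem dangerTime_ofReal (t : ℝ) : dangerTime Xd (ENNReal.ofReal t) x = timeSpent Xd 0 t x := by
  rw [dangerTime, timeSpent, timesBefore_ofReal, restrict_Ico_eq_restrict_Ioc]

theorem timeSpent_le_dangerTime {T : ℝ≥0∞} {t : ℝ} (h : ENNReal.ofReal t ≤ T) :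
    timeSpent Xd 0 t x ≤ dangerTime Xd T x := by
  rw [← dangerTime_ofReal]
  exact lintegral_mono_set (timesBefore_mono h)

theorem IsRun.init {T : ℝ≥0∞} (h : IsRun F u Xg x₀ T x d) : x 0 = x₀ := by
  simpa using h.eq_integral 0 ⟨le_rfl, by simp⟩

theorem IsRun.isSegment {T : ℝ≥0∞} (h : IsRun F u Xg x₀ T x d) {t : ℝ} (ht : 0 ≤ t)
    (htT : ENNReal.ofReal t ≤ T) : IsSegment (fun y δ => F y (u y) δ) Xg 0 t x d := by
  have hup := timesUpTo_mono htT
  have hbe := timesBefore_mono htT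
  rw [timesUpTo_ofReal ht] at hup
  rw [timesBefore_ofReal] at hbe
  refine ⟨ht, ?_, ?_, fun s hs => ?_, fun s hs => h.notMem_goal s (hbe hs)⟩
  · rw [← restrict_Ico_eq_restrict_Ioc]
    exact h.aemeasurable.mono_set hbe
  · exact (intervalIntegrable_iff_integrableOn_Ioc_of_le ht).1 (h.integrable t (hup ⟨ht, le_rfl⟩))
  · rw [h.init, ← intervalIntegral.integral_of_le hs.1]
    exact h.eq_integral s (hup hs)

theorem isRun_ofReal_iff {T : ℝ} (hT : 0 ≤ T) : IsRun F u Xg x₀ (ENNReal.ofReal T) x d ↔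
    IsFiniteRun (fun y δ => F y (u y) δ) Xg x₀ T x d := by
  constructor
  · intro h
    refine ⟨h.isSegment hT le_rfl, h.init, ?_⟩
    simpa [hT] using h.mem_goal ENNReal.ofReal_ne_top
  · intro h
    refine ⟨?_, fun t ht => ?_, fun t ht => ?_, fun t ht => ?_, fun _ => ?_⟩
    · rw [timesBefore_ofReal, restrict_Ico_eq_restrict_Ioc]
      exact h.aemeasurable
    · rw [timesUpTo_ofReal hT] at ht
      rw [intervalIntegrable_iff_integrableOn_Ioc_of_le ht.1]
      exact h.integrableOn.mono_set (Ioc_subset_Ioc le_rfl ht.2)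
    · rw [timesUpTo_ofReal hT] at ht
      rw [intervalIntegral.integral_of_le ht.1, ← h.init]
      exact h.eq_integral t ht
    · rw [timesBefore_ofReal] at ht
      exact h.notMem t ht
    · simpa [hT] using h.mem

theorem IsRun.dangerTime_le_worstValue {T : ℝ≥0∞} (h : IsRun F u Xg x₀ T x d) :
    dangerTime Xd T x ≤ worstValue F u Xd Xg x₀ :=
  le_iSup₂_of_le T x (le_iSup₂_of_le d h le_rfl)

/-- A run that enters the open set `Xd` spends a positive time there. -/
theorem IsRun.dangerTime_pos (hXd : IsOpen Xd) {T : ℝ≥0∞} (h : IsRun F u Xg x₀ T x d) {t : ℝ}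
    (ht : t ∈ timesBefore T) (hx : x t ∈ Xd) : 0 < dangerTime Xd T x := by
  -- `T` may be infinite, so a real horizon beyond `t` is chosen; only times after `t` are used, as
  -- `t` may be `0`.
  obtain ⟨r, htr, hrT⟩ := ENNReal.lt_iff_exists_nnreal_btwn.1 ht.2
  rw [← ENNReal.ofReal_coe_nnreal] at hrT htr
  have htr : t < r := (ENNReal.ofReal_lt_ofReal_iff_of_nonneg ht.1).1 htr
  have hc := (h.isSegment r.2 hrT.le).continuousOn t ⟨ht.1, htr.le⟩
  have hmem : ∀ᶠ s in nhdsWithin t (Icc 0 (r : ℝ)), x s ∈ Xd := hc (hXd.mem_nhds hx)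
  have hmem' : {s | x s ∈ Xd} ∈ nhdsWithin t (Ici t) := by
    have hle : nhdsWithin t (Icc t (r : ℝ)) ≤ nhdsWithin t (Icc 0 (r : ℝ)) :=
      nhdsWithin_mono _ (Icc_subset_Icc ht.1 le_rfl)
    rw [nhdsWithin_Icc_eq_nhdsGE htr] at hle
    exact hle hmem
  obtain ⟨q, hq, hsub⟩ := (mem_nhdsGE_iff_exists_Ico_subset' htr).1 hmem'
  have hq' : t < min q r := lt_min hq htr
  refine lt_of_lt_of_le ?_ (timeSpent_le_dangerTime hrT.le)
  calc 0 < volume (Ioo t (min q r)) := by simpa using hq'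
    _ = ∫⁻ s in Ioo t (min q r), Xd.indicator (fun _ => (1 : ℝ≥0∞)) (x s) := by
      rw [← setLIntegral_one]
      refine setLIntegral_congr_fun measurableSet_Ioo fun s hs => ?_
      have hs' : x s ∈ Xd := hsub ⟨hs.1.le, hs.2.trans_le (min_le_left _ _)⟩
      simp [hs']
    _ ≤ timeSpent Xd 0 r x :=
      lintegral_mono_set (Ioo_subset_Ioc_self.trans (Ioc_subset_Ioc ht.1 (min_le_right _ _)))

theorem forall_notMem_danger_iff_worstValue_eq_zero (hXd : IsOpen Xd) :
    (∀ (T : ℝ≥0∞) (x : ℝ → Euc n) (d : ℝ → D), IsRun F u Xg x₀ T x d →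
      ∀ t ∈ timesBefore T, x t ∉ Xd) ↔ worstValue F u Xd Xg x₀ = 0 := by
  constructor
  · intro h
    simp only [worstValue, ENNReal.iSup_eq_zero]
    intro T x d hr
    have hmeas : MeasurableSet (timesBefore T) :=
      measurableSet_Ici.inter (measurableSet_lt ENNReal.measurable_ofReal measurable_const)
    rw [dangerTime, setLIntegral_congr_fun hmeas (g := fun _ => 0), lintegral_zero]
    exact fun t ht => indicator_of_notMem (h T x d hr t ht) _
  · intro h T x d hr t ht hx
    exact (hr.dangerTime_pos hXd ht hx).ne' (le_antisymm (hr.dangerTime_le_worstValue.trans_eq h)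
      zero_le)

theorem IsWorstCase.isMaximalRun {T : ℝ≥0∞} (hT : T ≠ ∞)
    (h : IsWorstCase F u Xd Xg x₀ T x d) :
    IsMaximalRun (fun y δ => F y (u y) δ) Xd Xg x₀ T.toReal x d := by
  have hTr := ENNReal.ofReal_toReal hT
  obtain ⟨hr, hw⟩ := h
  rw [← hTr] at hr hw
  refine ⟨(isRun_ofReal_iff ENNReal.toReal_nonneg).1 hr, fun T' x' d' h' => ?_⟩
  rw [← dangerTime_ofReal, ← dangerTime_ofReal, hw]
  exact ((isRun_ofReal_iff h'.le).2 h').dangerTime_le_worstValue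

theorem exists_worstCase_feedback (hD : D.Nonempty) (hXd : IsOpen Xd) {Q : Set (Euc n)}
    (hQ : Q.Countable) (h : ∀ x₀ ∈ Q, ∃ (T : ℝ≥0∞) (x : ℝ → Euc n) (d : ℝ → D),
      T ≠ ∞ ∧ IsWorstCase F u Xd Xg x₀ T x d) :
    ∃ dstar : Euc n → D, Measurable dstar ∧ ∀ x₀ ∈ Q, ∃ (T : ℝ≥0∞) (x : ℝ → Euc n),
      T ≠ ∞ ∧ IsWorstCase F u Xd Xg x₀ T x (fun t => dstar (x t)) := by
  have : Nonempty D := hD.to_subtype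
  rcases Q.eq_empty_or_nonempty with rfl | hne
  · exact ⟨fun _ => Classical.arbitrary D, measurable_const, by simp⟩
  obtain ⟨z, rfl⟩ := hQ.exists_eq_range hne
  simp only [forall_mem_range] at h ⊢
  choose T x d hT hw using h
  choose T' x' e he hrun using fun k => ((hw k).isMaximalRun (hT k)).exists_feedback hXd
  obtain ⟨f, hf, hfrun⟩ := exists_common_feedback z T' x' e he hrun
  refine ⟨f, hf, fun k => ?_⟩
  obtain ⟨T₁, x₁, h₁, hle⟩ := hfrun k
  have hr := (isRun_ofReal_iff h₁.le).2 h₁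
  refine ⟨ENNReal.ofReal T₁, x₁, ENNReal.ofReal_ne_top, hr,
    le_antisymm hr.dangerTime_le_worstValue ?_⟩
  -- `IsMaximalRun` compares finite runs only, whereas `worstValue` also counts infinite ones;
  -- comparison with the given worst-case run, which is finite, bridges this.
  have hmax := (hrun k).max _ _ _ ((hw k).isMaximalRun (hT k)).toIsFiniteRun
  rw [← (hw k).2, ← ENNReal.ofReal_toReal (hT k), dangerTime_ofReal, dangerTime_ofReal]
  exact hmax.trans hle

end ClosedLoop

theorem mainTheorem6 {n m p : ℕ} (U : Set (Euc m)) (D : Set (Euc p)) (hD : D.Nonempty)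
    (F : Euc n → U → D → Euc n) (u : Euc n → U) (Xd Xg : Set (Euc n))
    (hXd : IsOpen Xd) (hXg : IsClosed Xg) :
    (∀ x₀ : Euc n,
      (∀ (T : ℝ≥0∞) (x : ℝ → Euc n) (d : ℝ → D), IsRun F u Xg x₀ T x d →
          ∀ t ∈ timesBefore T, x t ∉ Xd) ↔
        worstValue F u Xd Xg x₀ = 0) ∧
    (∀ Q : Set (Euc n), Q.Countable →
      (∀ x₀ ∈ Q, ∃ (T : ℝ≥0∞) (x : ℝ → Euc n) (d : ℝ → D),
          T ≠ ∞ ∧ IsWorstCase F u Xd Xg x₀ T x d) →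
      ∃ dstar : Euc n → D, Measurable dstar ∧
        ∀ x₀ ∈ Q, ∃ (T : ℝ≥0∞) (x : ℝ → Euc n),
          T ≠ ∞ ∧ IsWorstCase F u Xd Xg x₀ T x (fun t => dstar (x t))) :=
  ⟨fun _ => forall_notMem_danger_iff_worstValue_eq_zero hXd,
    fun _ hQ h => exists_worstCase_feedback hD hXd hQ h⟩
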